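/- Let $N$ (agents) and $M$ (items) be finite sets with $|N|=|M|$, and let $R=(\succ_j)_{j\in N}$ be a profile of strict linear orders on $M$. For $S\subseteq M$ nonempty, $\mathrm{top}_j(S)$ is the $\succ_j$-best item of $S$, and $U_j(o)=\{o'\in M: o'\succ_j o\}\cup\{o\}$. A random assignment is a doubly stochastic matrix $P=(p_{j,o})_{j\in N,o\in M}$. Ex-ante FERI. Given $P$, define recursively for $r=1,2,\dots$ the sets $M_{P,r}=\{o\in M:\sum_{k\in\bigcup_{1\le r'<r}E_{P,r'}(o)}p_{k,o}<1\}$ and, for $o \in M$, $E_{P,r}(o)=\{j\in N: o\in M_{P,r},\ o=\mathrm{top}_j(M_{P,r})\}$. The random assignment $P$ satisfies ex-ante favoring-eagerness-for-remaining-items (ex-ante FERI) if for every $r\ge 1$, every $o\in M_{P,r}$ and every agent $j$ with $j\in E_{P,r'}(o)$ for some $1\le r'<r$, we have $\sum_{o'\in U_j(o)}p_{j,o'}=1$. The algorithm $\mathrm{PRE}_\omega$. A collection of eating speed functions is a family $\omega=(\omega_j)_{j\in N}$ of functions that are integrable on $[0,1]$ with $\omega_j\ge 0$ on $[0,1]$,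 $\int_0^1\omega_j(t)\,dt=1$ and $\omega_j(t)=0$ for $t>1$. Start with $M'=M$, $p_{j,o}=0$, supplies $s(o)=1$ and elapsed times $t_j=0$ for all $j,o$. While $M'\ne\emptyset$, perform a round: for each $o\in M'$ let $N_o=\{j\in N:\mathrm{top}_j(M')=o\}$ and let $\rho_o$ be the least element of $$\Big\{\rho\ge 0:\sum_{k\in N_o}\int_{t_k}^{t_k+\rho}\omega_k(t)\,dt=s(o)\Big\}\cup\Big\{\rho\in[0,1]:\sum_{k\in N_o}\int_{t_k}^{t_k+\rho}\omega_k(t)\,dt=\sum_{k\in N_o}\int_{t_k}^{1}\omega_k(t)\,dt\Big\};$$ then for each $o\in M'$ and $j\in N_o$ increase $p_{j,o}$ by $\int_{t_j}^{t_j+\rho_o}\omega_j(t)\,dt$, decrease $s(o)$ by the sum of these amounts over $j\in N_o$, increase $t_j$ by $\rho_o$ for $j\in N_o$, and finally remove from $M'$ all items with $s(o)=0$. When the loop ends, output $\mathrm{PRE}_\omega(R)=(p_{j,o})$. Theorem. For every collection $\omega$ of eating speed functions the algorithm terminates and $\mathrm{PRE}_\omega(R)$ is a random assignment. A random assignment $P$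 satisfies ex-ante FERI if and only if there is a collection $\omega$ of eating speed functions such that $P=\mathrm{PRE}_\omega(R)$. -/

import Mathlib

open MeasureTheory

/-- A preference profile: for every agent `j` a strict linear order on the items;
`R.pref j a b` means that agent `j` strictly prefers `a` to `b`. -/
structure PrefProfile (N M : Type*) where
  pref : N → M → M → Prop
  strict : ∀ j, IsStrictTotalOrder M (pref j)

/-- A random assignment: a doubly stochastic matrix of shares, agents by items. -/
structure IsRandomAssignment {N M : Type*} [Fintype N] [Fintype M] (P : N → M → ℝ) : Prop where
  nonneg : ∀ j o, 0 ≤ P j o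
  row_sum : ∀ j, ∑ o, P j o = 1
  col_sum : ∀ o, ∑ j, P j o = 1

/-- `o` is the item of `S` that agent `j` ranks highest. -/
def IsTopItem {N M : Type*} (R : PrefProfile N M) (j : N) (S : Finset M) (o : M) : Prop :=
  o ∈ S ∧ ∀ o' ∈ S, o' ≠ o → R.pref j o o'

open scoped Classical in
/-- The items that agent `j` weakly prefers to `o`. -/
noncomputable def upperContour {N M : Type*} [Fintype M] (R : PrefProfile N M) (j : N) (o : M) :
    Finset M :=
  {o' | R.pref j o' o ∨ o' = o}

open scoped Classical in
/-- The agents whose top item in `S` is `o` (there are none if `o ∉ S`). -/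
noncomputable def topAgents {N M : Type*} [Fintype N] (R : PrefProfile N M) (S : Finset M)
    (o : M) : Finset N :=
  {j | IsTopItem R j S o}

/-! ### Ex-ante favoring eagerness for remaining items

Rounds are counted from `0`: round `r` here is the `(r + 1)`-st round. -/

open scoped Classical in
/-- The agents that are eager for `o` in some round before round `r`. -/
noncomputable def eagerBefore {N M : Type*} [Fintype N] [Fintype M] (R : PrefProfile N M)
    (P : N → M → ℝ) : ℕ → M → Finset N
  | 0 => fun _ => ∅
  | r + 1 => fun o => eagerBefore R P r o ∪
      topAgents R {o' | ∑ k ∈ eagerBefore R P r o', P k o' < 1} o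

open scoped Classical in
/-- The items whose supply is not used up by the agents eager for them before round `r`. -/
noncomputable def remainingItems {N M : Type*} [Fintype N] [Fintype M] (R : PrefProfile N M)
    (P : N → M → ℝ) (r : ℕ) : Finset M :=
  {o | ∑ k ∈ eagerBefore R P r o, P k o < 1}

/-- The agents that are eager for `o` in round `r`. -/
noncomputable def eagerAgents {N M : Type*} [Fintype N] [Fintype M] (R : PrefProfile N M)
    (P : N → M → ℝ) (r : ℕ) (o : M) : Finset N :=
  topAgents R (remainingItems R P r) o

theorem mem_eagerBefore {N M : Type*} [Fintype N] [Fintype M] (R : PrefProfile N M)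
    (P : N → M → ℝ) (r : ℕ) (o : M) (j : N) :
    j ∈ eagerBefore R P r o ↔ ∃ r' < r, j ∈ eagerAgents R P r' o := by
  classical
  induction r with
  | zero => simp [eagerBefore]
  | succ r ih =>
    have h : eagerBefore R P (r + 1) o = eagerBefore R P r o ∪ eagerAgents R P r o := by
      ext k
      simp only [eagerBefore, eagerAgents, remainingItems, Finset.mem_union]
    rw [h, Finset.mem_union, ih]
    constructor
    · rintro (⟨r', h1, h2⟩ | h2)
      · exact ⟨r', by omega, h2⟩
      · exact ⟨r, by omega, h2⟩
    · rintro ⟨r', h1, h2⟩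
      rcases Nat.lt_succ_iff_lt_or_eq.1 h1 with h3 | rfl
      · exact Or.inl ⟨r', h3, h2⟩
      · exact Or.inr h2

/-- Ex-ante favoring eagerness for remaining items: whenever an item remains in round `r`, all
agents that were eager for it in an earlier round are satisfied by items they weakly prefer
to it. -/
def ExAnteFERI {N M : Type*} [Fintype N] [Fintype M] (R : PrefProfile N M)
    (P : N → M → ℝ) : Prop :=
  ∀ r, ∀ o ∈ remainingItems R P r, ∀ j, (∃ r' < r, j ∈ eagerAgents R P r' o) →
    ∑ o' ∈ upperContour R j o, P j o' = 1

/-! ### The probabilistic respecting eagerness algorithm -/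

/-- An eating speed function. Its values at negative times play no role. -/
structure IsEatingSpeed (w : ℝ → ℝ) : Prop where
  integrable : IntervalIntegrable w volume 0 1
  integral_eq_one : ∫ t in (0 : ℝ)..1, w t = 1
  nonneg : ∀ t ∈ Set.Icc (0 : ℝ) 1, 0 ≤ w t
  eq_zero : ∀ t, 1 < t → w t = 0

/-- The durations after which the agents in `N'`, starting at their elapsed times `t`, have eaten
exactly the supply `s`, or have all together eaten their whole remaining demand. -/
def stoppingTimes {N : Type*} (ω : N → ℝ → ℝ) (N' : Finset N) (t : N → ℝ) (s : ℝ) : Set ℝ :=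
  {ρ | 0 ≤ ρ ∧ ∑ k ∈ N', ∫ x in (t k)..(t k + ρ), ω k x = s} ∪
  {ρ | ρ ∈ Set.Icc (0 : ℝ) 1 ∧
    ∑ k ∈ N', ∫ x in (t k)..(t k + ρ), ω k x = ∑ k ∈ N', ∫ x in (t k)..1, ω k x}

/-- The least stopping time (`isLeast_consumptionTime` shows that the minimum is attained). -/
noncomputable def consumptionTime {N : Type*} (ω : N → ℝ → ℝ) (N' : Finset N) (t : N → ℝ)
    (s : ℝ) : ℝ :=
  sInf (stoppingTimes ω N' t s)

theorem IsEatingSpeed.intervalIntegrable {w : ℝ → ℝ} (h : IsEatingSpeed w) {a b : ℝ}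
    (ha : 0 ≤ a) (hb : 0 ≤ b) : IntervalIntegrable w volume a b := by
  have h1 : ∀ c : ℝ, 0 ≤ c → IntervalIntegrable w volume 0 c := by
    intro c hc
    have h2 : IntervalIntegrable w volume 1 (max 1 c) := by
      refine (IntervalIntegrable.zero (μ := volume) (a := 1) (b := max 1 c)).congr ?_
      intro x hx
      rw [Set.uIoc_of_le (le_max_left _ _)] at hx
      simp [h.eq_zero x hx.1]
    refine (h.integrable.trans h2).mono_set ?_
    rw [Set.uIcc_of_le hc, Set.uIcc_of_le (le_trans zero_le_one (le_max_left _ _))]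
    exact Set.Icc_subset_Icc le_rfl (le_max_right _ _)
  exact (h1 a ha).symm.trans (h1 b hb)

theorem IsEatingSpeed.continuousOn {w : ℝ → ℝ} (h : IsEatingSpeed w) {a : ℝ} (ha : 0 ≤ a) :
    ContinuousOn (fun ρ => ∫ x in a..(a + ρ), w x) (Set.Ici 0) := by
  intro ρ hρ
  have hρ' : (0 : ℝ) ≤ ρ := hρ
  have h1 : ContinuousOn (fun b => ∫ x in a..b, w x) (Set.uIcc a (a + ρ + 1)) :=
    intervalIntegral.continuousOn_primitive_interval
      ((intervalIntegrable_iff').1 (h.intervalIntegrable ha (by positivity)))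
  rw [Set.uIcc_of_le (by linarith)] at h1
  have h2 : ContinuousOn (fun ρ' => ∫ x in a..(a + ρ'), w x) (Set.Icc 0 (ρ + 1)) := by
    refine h1.comp (f := fun ρ' => a + ρ') (by fun_prop) ?_
    intro x hx
    exact ⟨by linarith [hx.1], by linarith [hx.2]⟩
  refine (h2 ρ ⟨hρ', by linarith⟩).mono_of_mem_nhdsWithin ?_
  rw [← Set.Ici_inter_Iic]
  exact Filter.inter_mem self_mem_nhdsWithin
    (mem_nhdsWithin_of_mem_nhds (Iic_mem_nhds (by linarith)))

theorem isLeast_consumptionTime {N : Type*} {ω : N → ℝ → ℝ} (hω : ∀ j, IsEatingSpeed (ω j))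
    (N' : Finset N) {t : N → ℝ} (ht : ∀ j, 0 ≤ t j) (s : ℝ) :
    IsLeast (stoppingTimes ω N' t s) (consumptionTime ω N' t s) := by
  have hc : ContinuousOn (fun ρ => ∑ k ∈ N', ∫ x in (t k)..(t k + ρ), ω k x) (Set.Ici 0) :=
    continuousOn_finsetSum _ fun k _ => (hω k).continuousOn (ht k)
  have hclosed : IsClosed (stoppingTimes ω N' t s) := by
    refine IsClosed.union ?_ ?_
    · exact hc.preimage_isClosed_of_isClosed isClosed_Ici (isClosed_singleton (x := s))
    · exact (hc.mono Set.Icc_subset_Ici_self).preimage_isClosed_of_isClosed isClosed_Icc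
        (isClosed_singleton (x := ∑ k ∈ N', ∫ x in (t k)..1, ω k x))
  have hne : (stoppingTimes ω N' t s).Nonempty := by
    refine ⟨1, Or.inr ⟨by simp, Finset.sum_congr rfl fun k _ => ?_⟩⟩
    have h0 : ∫ x in (1 : ℝ)..(t k + 1), ω k x = 0 := by
      rw [intervalIntegral.integral_of_le (by linarith [ht k])]
      exact setIntegral_eq_zero_of_forall_eq_zero fun x hx => (hω k).eq_zero x hx.1
    rw [← intervalIntegral.integral_add_adjacent_intervals
      ((hω k).intervalIntegrable (ht k) zero_le_one)
      ((hω k).intervalIntegrable zero_le_one (by linarith [ht k])), h0, add_zero]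
  have hbdd : BddBelow (stoppingTimes ω N' t s) := by
    refine ⟨0, ?_⟩
    rintro ρ (h | h)
    · exact h.1
    · exact h.1.1
  exact ⟨hclosed.csInf_mem hne hbdd, fun ρ h => csInf_le hbdd h⟩

/-- The state of the algorithm: the set of available items, the remaining supply of each item,
the elapsed consumption time of each agent, and the shares eaten so far. -/
structure PREState (N M : Type*) where
  available : Finset M
  supply : M → ℝ
  time : N → ℝ
  share : N → M → ℝ

def PREState.init (N M : Type*) [Fintype M] : PREState N M where
  available := Finset.univ
  supply := fun _ => 1
  time := fun _ => 0
  share := fun _ _ => 0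

/-- The duration for which item `o` is eaten in the round that starts in state `σ`. -/
noncomputable def PREState.duration {N M : Type*} [Fintype N] (R : PrefProfile N M)
    (ω : N → ℝ → ℝ) (σ : PREState N M) (o : M) : ℝ :=
  consumptionTime ω (topAgents R σ.available o) σ.time (σ.supply o)

/-- The amount of `o` eaten in the round that starts in state `σ` by agent `j`, if `o` is the top
available item of `j`. -/
noncomputable def PREState.amount {N M : Type*} [Fintype N] (R : PrefProfile N M)
    (ω : N → ℝ → ℝ) (σ : PREState N M) (j : N) (o : M) : ℝ :=
  ∫ x in (σ.time j)..(σ.time j + σ.duration R ω o), ω j x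

/-- The supply left after the round that starts in state `σ`. -/
noncomputable def PREState.nextSupply {N M : Type*} [Fintype N] (R : PrefProfile N M)
    (ω : N → ℝ → ℝ) (σ : PREState N M) (o : M) : ℝ :=
  σ.supply o - ∑ k ∈ topAgents R σ.available o, σ.amount R ω k o

open scoped Classical in
/-- One round: every agent eats her top available item, all agents eating the same item for the
same duration; then the exhausted items are removed. The sum in `time` has at most one nonzero
term, that of the item that `j` eats. -/
noncomputable def PREState.step {N M : Type*} [Fintype N] (R : PrefProfile N M)
    (ω : N → ℝ → ℝ) (σ : PREState N M) : PREState N M where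
  available := {o ∈ σ.available | σ.nextSupply R ω o ≠ 0}
  supply := σ.nextSupply R ω
  time := fun j => σ.time j +
    ∑ o ∈ σ.available, if j ∈ topAgents R σ.available o then σ.duration R ω o else 0
  share := fun j o => σ.share j o +
    if j ∈ topAgents R σ.available o then σ.amount R ω j o else 0

/-- The state after `r` rounds. -/
noncomputable def preState {N M : Type*} [Fintype N] [Fintype M] (R : PrefProfile N M)
    (ω : N → ℝ → ℝ) (r : ℕ) : PREState N M :=
  (PREState.step R ω)^[r] (PREState.init N M)

/-- The loop ends: at some point no item is available any more. -/
def PREHalts {N M : Type*} [Fintype N] [Fintype M] (R : PrefProfile N M)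
    (ω : N → ℝ → ℝ) : Prop :=
  ∃ r, (preState R ω r).available = ∅

open scoped Classical in
/-- The output of the algorithm: the shares when the loop ends (and `0` if it does not end). -/
noncomputable def PRE {N M : Type*} [Fintype N] [Fintype M] (R : PrefProfile N M)
    (ω : N → ℝ → ℝ) : N → M → ℝ :=
  if h : PREHalts R ω then (preState R ω (Nat.find h)).share else 0

/-!
The shares eaten in the first `r` rounds of `PRE` are exactly those that its output gives to agents
who are eager before round `r`: once an agent has eaten an item for a round, the item has run out or
she is sated, so her share of it is final. If the item remains, she is sated, and everything she ate
was then at least as good for her as this item; hence the output satisfies ex-ante FERI.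

Conversely, split `[0, 1]` into `|M|` equal parts and let every agent eat at a constant rate, during
the `r`-th part, the share that `P` gives her by being eager in round `r`. An item that leaves the
FERI recursion in round `r` is then eaten for exactly `1 / |M|`. The agents eager for an item that
remains are satisfied by ex-ante FERI and eat up their whole demand, so that it no longer matters
how long that round takes for them.
-/

lemma eq_empty_of_antitone_of_card_le {α : Type*} [Fintype α] {S : ℕ → Finset α}
    (hS : Antitone S) (hne : ∀ r, S (r + 1) = S r → S r = ∅) {r : ℕ}
    (hr : Fintype.card α ≤ r) : S r = ∅ := by
  have card_le : ∀ r, (S r).card ≤ Fintype.card α - r := by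
    intro r
    induction r with
    | zero => exact Finset.card_le_univ _
    | succ r ih =>
      rcases (hS (Nat.le_add_right r 1)).eq_or_lt with heq | hlt
      · rw [heq, hne r heq, Finset.card_empty]
        exact Nat.zero_le _
      · have := Finset.card_lt_card hlt
        omega
  simpa [Nat.sub_eq_zero_of_le hr] using card_le r

namespace IsEatingSpeed

variable {w : ℝ → ℝ} {t ρ : ℝ}

lemma nonneg_of_nonneg (hw : IsEatingSpeed w) (ht : 0 ≤ t) : 0 ≤ w t := by
  rcases le_or_gt t 1 with hle | hlt
  · exact hw.nonneg t ⟨ht, hle⟩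
  · exact (hw.eq_zero t hlt).ge

lemma integral_nonneg (hw : IsEatingSpeed w) (ht : 0 ≤ t) (hρ : 0 ≤ ρ) :
    0 ≤ ∫ x in t..(t + ρ), w x :=
  intervalIntegral.integral_nonneg (le_add_of_nonneg_right hρ) fun _ hx =>
    hw.nonneg_of_nonneg (ht.trans hx.1)

lemma integral_to_one_nonneg (hw : IsEatingSpeed w) (ht : 0 ≤ t) : 0 ≤ ∫ x in t..1, w x := by
  rcases le_total t 1 with hle | hge
  · exact intervalIntegral.integral_nonneg hle fun _ hx => hw.nonneg_of_nonneg (ht.trans hx.1)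
  · rw [intervalIntegral.integral_symm, intervalIntegral.integral_of_le hge,
      setIntegral_eq_zero_of_forall_eq_zero fun x hx => hw.eq_zero x hx.1, neg_zero]

lemma integral_add_integral_to_one (hw : IsEatingSpeed w) (ht : 0 ≤ t) (hρ : 0 ≤ ρ) :
    (∫ x in t..(t + ρ), w x) + ∫ x in (t + ρ)..1, w x = ∫ x in t..1, w x :=
  intervalIntegral.integral_add_adjacent_intervals
    (hw.intervalIntegrable ht (by positivity)) (hw.intervalIntegrable (by positivity) zero_le_one)

lemma integral_le_integral_to_one (hw : IsEatingSpeed w) (ht : 0 ≤ t) (hρ : 0 ≤ ρ) :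
    ∫ x in t..(t + ρ), w x ≤ ∫ x in t..1, w x := by
  rw [← hw.integral_add_integral_to_one ht hρ]
  exact le_add_of_nonneg_right (hw.integral_to_one_nonneg (by positivity))

end IsEatingSpeed

section ConsumptionTime

variable {N : Type*} {ω : N → ℝ → ℝ} {N' : Finset N} {t : N → ℝ} {s : ℝ}

lemma consumptionTime_nonneg (hω : ∀ j, IsEatingSpeed (ω j)) (ht : ∀ j, 0 ≤ t j) :
    0 ≤ consumptionTime ω N' t s := by
  rcases (isLeast_consumptionTime hω N' ht s).1 with hsupply | hdemand
  exacts [hsupply.1, hdemand.1.1]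

lemma sum_integral_consumptionTime_le (hω : ∀ j, IsEatingSpeed (ω j)) (ht : ∀ j, 0 ≤ t j)
    (hs : 0 ≤ s) :
    ∑ k ∈ N', ∫ x in (t k)..(t k + consumptionTime ω N' t s), ω k x ≤ s := by
  by_contra! hlt
  have hcont : ContinuousOn (fun ρ => ∑ k ∈ N', ∫ x in (t k)..(t k + ρ), ω k x)
      (Set.Icc 0 (consumptionTime ω N' t s)) :=
    (continuousOn_finsetSum _ fun k _ => (hω k).continuousOn (ht k)).mono Set.Icc_subset_Ici_self
  obtain ⟨ρ, hρ, hsum⟩ := intermediate_value_Icc (consumptionTime_nonneg hω ht) hcont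
    (show s ∈ Set.Icc _ _ from ⟨by simpa using hs, hlt.le⟩)
  have hle : consumptionTime ω N' t s ≤ ρ :=
    (isLeast_consumptionTime hω N' ht s).2 (Or.inl ⟨hρ.1, hsum⟩)
  rw [le_antisymm hle hρ.2] at hlt
  exact hlt.ne' hsum

lemma sum_integral_consumptionTime_eq_or (hω : ∀ j, IsEatingSpeed (ω j)) (ht : ∀ j, 0 ≤ t j) :
    ∑ k ∈ N', ∫ x in (t k)..(t k + consumptionTime ω N' t s), ω k x = s ∨
      ∀ k ∈ N', ∫ x in (t k + consumptionTime ω N' t s)..1, ω k x = 0 := by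
  refine (isLeast_consumptionTime hω N' ht s).1.imp And.right fun hdemand k hk => ?_
  have hρ : 0 ≤ consumptionTime ω N' t s := hdemand.1.1
  have heaten := (Finset.sum_eq_sum_iff_of_le fun k _ =>
    (hω k).integral_le_integral_to_one (ht k) hρ).1 hdemand.2 k hk
  rwa [← (hω k).integral_add_integral_to_one (ht k) hρ, left_eq_add] at heaten

lemma consumptionTime_eq (hω : ∀ j, IsEatingSpeed (ω j)) (ht : ∀ j, 0 ≤ t j) {δ : ℝ}
    (hδ : 0 ≤ δ) (heq : ∑ k ∈ N', ∫ x in (t k)..(t k + δ), ω k x = s)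
    (hlt : ∀ ρ, 0 ≤ ρ → ρ < δ → ∑ k ∈ N', ∫ x in (t k)..(t k + ρ), ω k x < s) :
    consumptionTime ω N' t s = δ := by
  have hdemand : s ≤ ∑ k ∈ N', ∫ x in (t k)..1, ω k x :=
    heq ▸ Finset.sum_le_sum fun k _ => (hω k).integral_le_integral_to_one (ht k) hδ
  refine IsLeast.csInf_eq ⟨Or.inl ⟨hδ, heq⟩, fun ρ hρ => ?_⟩
  by_contra! hρδ
  rcases hρ with ⟨hρ, hsupply⟩ | ⟨hρ, hsated⟩
  · exact (hlt ρ hρ hρδ).ne hsupply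
  · exact (hlt ρ hρ.1 hρδ).not_ge (hsated ▸ hdemand)

end ConsumptionTime

section TopItem

variable {N M : Type*} {R : PrefProfile N M} {j : N} {S : Finset M} {o o' : M}

instance PrefProfile.isStrictTotalOrder (R : PrefProfile N M) (j : N) :
    IsStrictTotalOrder M (R.pref j) :=
  R.strict j

lemma IsTopItem.notMem_of_pref (h : IsTopItem R j S o) (hpref : R.pref j o' o) : o' ∉ S := by
  intro ho'
  by_cases heq : o' = o
  · exact irrefl_of (R.pref j) o (heq ▸ hpref)
  · exact asymm_of (R.pref j) hpref (h.2 o' ho' heq)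

lemma IsTopItem.unique (h : IsTopItem R j S o) (h' : IsTopItem R j S o') : o' = o := by
  by_contra hne
  exact h.notMem_of_pref (h'.2 o h.1 (Ne.symm hne)) h'.1

lemma exists_isTopItem (R : PrefProfile N M) (j : N) (hS : S.Nonempty) :
    ∃ o, IsTopItem R j S o := by
  classical
  let := linearOrderOfSTO (R.pref j)
  exact ⟨S.min' hS, S.min'_mem hS, fun o' ho' hne => (S.min'_le o' ho').lt_of_ne' hne⟩

lemma mem_upperContour [Fintype M] : o' ∈ upperContour R j o ↔ R.pref j o' o ∨ o' = o := by
  simp [upperContour]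

lemma IsTopItem.mem_upperContour [Fintype M] (h : IsTopItem R j S o') (ho : o ∈ S) :
    o' ∈ upperContour R j o := by
  rw [_root_.mem_upperContour]
  by_cases heq : o' = o
  · exact Or.inr heq
  · exact Or.inl (h.2 o ho (Ne.symm heq))

variable [Fintype N]

lemma mem_topAgents : j ∈ topAgents R S o ↔ IsTopItem R j S o := by
  simp [topAgents]

lemma exists_mem_topAgents (R : PrefProfile N M) (j : N) (hS : S.Nonempty) :
    ∃ o, j ∈ topAgents R S o := by
  simpa only [mem_topAgents] using exists_isTopItem R j hS

lemma eq_of_mem_topAgents (h : j ∈ topAgents R S o) (h' : j ∈ topAgents R S o') : o' = o :=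
  (mem_topAgents.1 h).unique (mem_topAgents.1 h')

lemma topAgents_empty : topAgents R ∅ o = ∅ := by
  simp [topAgents, IsTopItem]

end TopItem

namespace PREState

/-- Agent `j` has eaten her whole demand of one unit. -/
def IsSated {N M : Type*} [Fintype M] (σ : PREState N M) (j : N) : Prop :=
  ∑ o, σ.share j o = 1

variable {N M : Type*} [Fintype N] {R : PrefProfile N M} {ω : N → ℝ → ℝ} {σ : PREState N M}
  {j : N} {o : M}

lemma step_eq_self (h : σ.available = ∅) : σ.step R ω = σ := by
  cases σ
  simp_all [step, nextSupply, topAgents_empty, funext_iff]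

lemma step_available_subset : (σ.step R ω).available ⊆ σ.available :=
  Finset.filter_subset _ _

lemma step_share_of_mem (h : j ∈ topAgents R σ.available o) :
    (σ.step R ω).share j o = σ.share j o + σ.amount R ω j o := by
  simp [step, h]

lemma step_share_of_notMem (h : j ∉ topAgents R σ.available o) :
    (σ.step R ω).share j o = σ.share j o := by
  simp [step, h]

lemma step_time_of_mem (h : j ∈ topAgents R σ.available o) :
    (σ.step R ω).time j = σ.time j + σ.duration R ω o := by
  classical
  simp only [step]
  rw [Finset.sum_eq_single_of_mem o (mem_topAgents.1 h).1 fun o' _ hne =>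
    if_neg fun h' => hne (eq_of_mem_topAgents h h'), if_pos h]

lemma sum_step_share (o : M) :
    ∑ j, (σ.step R ω).share j o =
      ∑ j, σ.share j o + ∑ j ∈ topAgents R σ.available o, σ.amount R ω j o := by
  classical
  simp only [step]
  rw [Finset.sum_add_distrib, Finset.sum_ite_mem, Finset.univ_inter]

variable [Fintype M]

lemma sum_step_share_of_mem (h : j ∈ topAgents R σ.available o) :
    ∑ o', (σ.step R ω).share j o' = ∑ o', σ.share j o' + σ.amount R ω j o := by
  classical
  simp only [step]
  rw [Finset.sum_add_distrib, Finset.sum_eq_single_of_mem o (Finset.mem_univ o) fun o' _ hne =>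
    if_neg fun h' => hne (eq_of_mem_topAgents h h'), if_pos h]

/-- The loop invariant of the algorithm: the available items, the supplies and the remaining
demands are the ones determined by the shares eaten so far. -/
structure Consistent (ω : N → ℝ → ℝ) (σ : PREState N M) : Prop where
  time_nonneg : ∀ j, 0 ≤ σ.time j
  share_nonneg : ∀ j o, 0 ≤ σ.share j o
  supply_nonneg : ∀ o, 0 ≤ σ.supply o
  supply_eq : ∀ o, σ.supply o = 1 - ∑ j, σ.share j o
  demand_eq : ∀ j, ∫ x in (σ.time j)..1, ω j x = 1 - ∑ o, σ.share j o
  mem_available : ∀ o, o ∈ σ.available ↔ σ.supply o ≠ 0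

lemma consistent_init (hω : ∀ j, IsEatingSpeed (ω j)) : (init N M).Consistent ω where
  time_nonneg := by simp [init]
  share_nonneg := by simp [init]
  supply_nonneg := by simp [init]
  supply_eq := by simp [init]
  demand_eq := fun j => by simp [init, (hω j).integral_eq_one]
  mem_available := by simp [init]

namespace Consistent

lemma supply_pos (h : σ.Consistent ω) (ho : o ∈ σ.available) : 0 < σ.supply o :=
  (h.supply_nonneg o).lt_of_ne' ((h.mem_available o).1 ho)

lemma sum_supply (h : σ.Consistent ω) :
    ∑ o, σ.supply o = Fintype.card M - ∑ j, ∑ o, σ.share j o := by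
  simp only [h.supply_eq]
  rw [Finset.sum_sub_distrib, Finset.sum_comm]
  simp

lemma sum_share_le (h : σ.Consistent ω) (hω : ∀ j, IsEatingSpeed (ω j)) (j : N) :
    ∑ o, σ.share j o ≤ 1 := by
  rw [← sub_nonneg, ← h.demand_eq]
  exact (hω j).integral_to_one_nonneg (h.time_nonneg j)

lemma duration_nonneg (h : σ.Consistent ω) (hω : ∀ j, IsEatingSpeed (ω j)) (o : M) :
    0 ≤ σ.duration R ω o :=
  consumptionTime_nonneg hω h.time_nonneg

lemma amount_nonneg (h : σ.Consistent ω) (hω : ∀ j, IsEatingSpeed (ω j)) (j : N) (o : M) :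
    0 ≤ σ.amount R ω j o :=
  (hω j).integral_nonneg (h.time_nonneg j) (h.duration_nonneg hω o)

lemma nextSupply_nonneg (h : σ.Consistent ω) (hω : ∀ j, IsEatingSpeed (ω j)) (o : M) :
    0 ≤ σ.nextSupply R ω o :=
  sub_nonneg.2 (sum_integral_consumptionTime_le hω h.time_nonneg (h.supply_nonneg o))

lemma nextSupply_le (h : σ.Consistent ω) (hω : ∀ j, IsEatingSpeed (ω j)) (o : M) :
    σ.nextSupply R ω o ≤ σ.supply o :=
  sub_le_self _ (Finset.sum_nonneg fun j _ => h.amount_nonneg hω j o)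

lemma share_le_step (h : σ.Consistent ω) (hω : ∀ j, IsEatingSpeed (ω j)) (j : N) (o : M) :
    σ.share j o ≤ (σ.step R ω).share j o := by
  by_cases hj : j ∈ topAgents R σ.available o
  · rw [step_share_of_mem hj]
    exact le_add_of_nonneg_right (h.amount_nonneg hω j o)
  · rw [step_share_of_notMem hj]

lemma integral_step_time_of_mem (h : σ.Consistent ω) (hω : ∀ j, IsEatingSpeed (ω j))
    (hj : j ∈ topAgents R σ.available o) :
    ∫ x in ((σ.step R ω).time j)..1, ω j x = 1 - ∑ o', (σ.step R ω).share j o' := by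
  rw [step_time_of_mem hj, sum_step_share_of_mem hj, ← sub_sub, ← h.demand_eq,
    ← (hω j).integral_add_integral_to_one (h.time_nonneg j) (h.duration_nonneg hω o), amount,
    add_sub_cancel_left]

protected lemma step (h : σ.Consistent ω) (hω : ∀ j, IsEatingSpeed (ω j)) :
    (σ.step R ω).Consistent ω := by
  rcases σ.available.eq_empty_or_nonempty with hempty | hne
  · rwa [step_eq_self hempty]
  refine ⟨fun j => ?_, fun j o => (h.share_nonneg j o).trans (h.share_le_step hω j o),
    h.nextSupply_nonneg hω, fun o => ?_, fun j => ?_, fun o => ?_⟩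
  · obtain ⟨o, hj⟩ := exists_mem_topAgents R j hne
    rw [step_time_of_mem hj]
    exact add_nonneg (h.time_nonneg j) (h.duration_nonneg hω o)
  · rw [sum_step_share, ← sub_sub, ← h.supply_eq]
    rfl
  · obtain ⟨o, hj⟩ := exists_mem_topAgents R j hne
    exact h.integral_step_time_of_mem hω hj
  · have hmem : o ∈ (σ.step R ω).available ↔ o ∈ σ.available ∧ σ.nextSupply R ω o ≠ 0 :=
      Finset.mem_filter
    rw [hmem, and_iff_right_of_imp]
    · rfl
    · intro hnext
      rw [h.mem_available]
      exact (((h.nextSupply_nonneg hω o).lt_of_ne' hnext).trans_le (h.nextSupply_le hω o)).ne'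

lemma isSated_step (h : σ.Consistent ω) (hω : ∀ j, IsEatingSpeed (ω j))
    (hj : j ∈ topAgents R σ.available o) (ho : o ∈ (σ.step R ω).available) :
    (σ.step R ω).IsSated j := by
  have hsupply : σ.nextSupply R ω o ≠ 0 := ((h.step hω).mem_available o).1 ho
  rcases sum_integral_consumptionTime_eq_or hω h.time_nonneg with hexhausted | hsated
  · exact absurd (sub_eq_zero.2 hexhausted.symm) hsupply
  · have hdemand := h.integral_step_time_of_mem hω hj
    rw [step_time_of_mem hj, duration, hsated j hj] at hdemand
    exact (sub_eq_zero.1 hdemand.symm).symm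

/-- If no item runs out in a round, then every agent is sated, so that the total supply left is at
most `|M| - |N| ≤ 0`. -/
lemma step_available_ne (h : σ.Consistent ω) (hω : ∀ j, IsEatingSpeed (ω j))
    (hcard : Fintype.card M ≤ Fintype.card N) (hne : σ.available.Nonempty) :
    (σ.step R ω).available ≠ σ.available := by
  intro heq
  have hstep : (σ.step R ω).Consistent ω := h.step hω
  have hsated : ∀ j, ∑ o, (σ.step R ω).share j o = 1 := fun j => by
    obtain ⟨o, hj⟩ := exists_mem_topAgents R j hne
    exact h.isSated_step hω hj (heq ▸ (mem_topAgents.1 hj).1)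
  have hsupply : ∑ o, (σ.step R ω).supply o ≤ 0 := by
    rw [hstep.sum_supply, sub_nonpos]
    simpa [hsated] using hcard
  obtain ⟨o, ho⟩ := hne
  exact hsupply.not_gt (Finset.sum_pos' (fun o _ => hstep.supply_nonneg o)
    ⟨o, Finset.mem_univ o, hstep.supply_pos (heq ▸ ho)⟩)

end Consistent

end PREState

section Run

variable {N M : Type*} [Fintype N] [Fintype M] {R : PrefProfile N M} {ω : N → ℝ → ℝ}
  {r s : ℕ} {j : N} {o : M}

lemma preState_succ (R : PrefProfile N M) (ω : N → ℝ → ℝ) (r : ℕ) :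
    preState R ω (r + 1) = (preState R ω r).step R ω :=
  Function.iterate_succ_apply' _ _ _

lemma preState_consistent (R : PrefProfile N M) (hω : ∀ j, IsEatingSpeed (ω j)) (r : ℕ) :
    (preState R ω r).Consistent ω := by
  induction r with
  | zero => exact PREState.consistent_init hω
  | succ r ih => exact preState_succ R ω r ▸ ih.step hω

lemma preState_available_antitone (R : PrefProfile N M) (ω : N → ℝ → ℝ) :
    Antitone fun r => (preState R ω r).available :=
  antitone_nat_of_succ_le fun r => preState_succ R ω r ▸ PREState.step_available_subset

lemma preState_share_monotone (R : PrefProfile N M) (hω : ∀ j, IsEatingSpeed (ω j)) (j : N)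
    (o : M) : Monotone fun r => (preState R ω r).share j o :=
  monotone_nat_of_le_succ fun r =>
    preState_succ R ω r ▸ (preState_consistent R hω r).share_le_step hω j o

lemma preHalts (hcard : Fintype.card M ≤ Fintype.card N) (R : PrefProfile N M)
    (hω : ∀ j, IsEatingSpeed (ω j)) : PREHalts R ω := by
  refine ⟨Fintype.card M, eq_empty_of_antitone_of_card_le (preState_available_antitone R ω)
    (fun r heq => ?_) le_rfl⟩
  by_contra hne
  rw [preState_succ] at heq
  exact (preState_consistent R hω r).step_available_ne hω hcard
    (Finset.nonempty_iff_ne_empty.2 hne) heq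

lemma preState_eq_of_available_eq_empty (h : (preState R ω r).available = ∅) (hrs : r ≤ s) :
    preState R ω s = preState R ω r := by
  induction s, hrs using Nat.le_induction with
  | base => rfl
  | succ s _ ih => rw [preState_succ, ih, PREState.step_eq_self h]

lemma PRE_eq_share (h : (preState R ω r).available = ∅) :
    PRE R ω = (preState R ω r).share := by
  classical
  have hhalts : PREHalts R ω := ⟨r, h⟩
  rw [PRE, dif_pos hhalts,
    preState_eq_of_available_eq_empty (Nat.find_spec hhalts) (Nat.find_min' hhalts h)]

lemma PREHalts.exists_ge_PRE_eq_share (h : PREHalts R ω) (r : ℕ) :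
    ∃ s ≥ r, PRE R ω = (preState R ω s).share := by
  obtain ⟨r₀, hr₀⟩ := h
  refine ⟨max r r₀, le_max_left .., PRE_eq_share ?_⟩
  rw [preState_eq_of_available_eq_empty hr₀ (le_max_right ..), hr₀]

lemma isRandomAssignment_PRE (hcard : Fintype.card N = Fintype.card M) (R : PrefProfile N M)
    (hω : ∀ j, IsEatingSpeed (ω j)) : IsRandomAssignment (PRE R ω) := by
  obtain ⟨r, hr⟩ := preHalts hcard.ge R hω
  rw [PRE_eq_share hr]
  have hcons := preState_consistent R hω r
  have hsupply : ∀ o, (preState R ω r).supply o = 0 := fun o => by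
    simpa [hr] using hcons.mem_available o
  have htotal : ∑ j, ∑ o, (preState R ω r).share j o = ∑ _j : N, (1 : ℝ) := by
    have hsum := hcons.sum_supply
    simp only [hsupply, Finset.sum_const_zero] at hsum
    simpa [hcard] using (sub_eq_zero.1 hsum.symm).symm
  refine ⟨hcons.share_nonneg, fun j => ?_, fun o => ?_⟩
  · exact (Finset.sum_eq_sum_iff_of_le fun j _ => hcons.sum_share_le hω j).1 htotal j
      (Finset.mem_univ j)
  · rw [← sub_eq_zero, ← neg_sub, ← hcons.supply_eq, hsupply, neg_zero]

lemma preState_share_eq_of_isSated (hω : ∀ j, IsEatingSpeed (ω j))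
    (h : (preState R ω r).IsSated j) (hrs : r ≤ s) (o : M) :
    (preState R ω r).share j o = (preState R ω s).share j o := by
  have hle : ∀ o' ∈ Finset.univ, (preState R ω r).share j o' ≤ (preState R ω s).share j o' :=
    fun o' _ => preState_share_monotone R hω j o' hrs
  refine (Finset.sum_eq_sum_iff_of_le hle).1 ?_ o (Finset.mem_univ o)
  exact (Finset.sum_le_sum hle).antisymm
    (((preState_consistent R hω s).sum_share_le hω j).trans h.ge)

lemma preState_isSated (hω : ∀ j, IsEatingSpeed (ω j))
    (hj : j ∈ topAgents R (preState R ω r).available o)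
    (ho : o ∈ (preState R ω (r + 1)).available) : (preState R ω (r + 1)).IsSated j := by
  rw [preState_succ] at ho ⊢
  exact (preState_consistent R hω r).isSated_step hω hj ho

/-- After the round the item has run out or the agent is sated. -/
lemma preState_share_eq_of_mem_topAgents (hω : ∀ j, IsEatingSpeed (ω j))
    (hj : j ∈ topAgents R (preState R ω r).available o) (hrs : r + 1 ≤ s) :
    (preState R ω (r + 1)).share j o = (preState R ω s).share j o := by
  induction s, hrs using Nat.le_induction with
  | base => rfl
  | succ s hrs ih =>
    by_cases hs : j ∈ topAgents R (preState R ω s).available o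
    · have ho : o ∈ (preState R ω (r + 1)).available :=
        preState_available_antitone R ω hrs (mem_topAgents.1 hs).1
      exact preState_share_eq_of_isSated hω (preState_isSated hω hj ho) (by omega) o
    · rw [ih, preState_succ R ω s, PREState.step_share_of_notMem hs]

end Run

section Eager

variable {N M : Type*} [Fintype N] [Fintype M] {R : PrefProfile N M} {P : N → M → ℝ}
  {r s : ℕ} {j : N} {o o' : M}

open scoped Classical in
/-- The share of `o` that agent `j` gets by being eager for it before round `r`. -/
noncomputable def eagerShare (R : PrefProfile N M) (P : N → M → ℝ) (r : ℕ) (j : N) (o : M) : ℝ :=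
  if j ∈ eagerBefore R P r o then P j o else 0

lemma eagerShare_of_mem (h : j ∈ eagerBefore R P r o) : eagerShare R P r j o = P j o :=
  if_pos h

lemma eagerShare_of_notMem (h : j ∉ eagerBefore R P r o) : eagerShare R P r j o = 0 :=
  if_neg h

lemma eagerShare_zero : eagerShare R P 0 j o = 0 :=
  eagerShare_of_notMem (Finset.notMem_empty j)

lemma mem_eagerBefore_succ :
    j ∈ eagerBefore R P (r + 1) o ↔ j ∈ eagerBefore R P r o ∨ j ∈ eagerAgents R P r o := by
  simp only [mem_eagerBefore, Nat.exists_lt_succ_right]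

lemma eagerShare_succ_of_mem (h : j ∈ eagerAgents R P r o) : eagerShare R P (r + 1) j o = P j o :=
  eagerShare_of_mem (mem_eagerBefore_succ.2 (Or.inr h))

lemma eagerShare_succ_of_notMem (h : j ∉ eagerAgents R P r o) :
    eagerShare R P (r + 1) j o = eagerShare R P r j o := by
  classical
  simp only [eagerShare, mem_eagerBefore_succ, or_iff_left h]

lemma mem_remainingItems : o ∈ remainingItems R P r ↔ ∑ j, eagerShare R P r j o < 1 := by
  classical
  rw [remainingItems, Finset.mem_filter_univ]
  simp only [eagerShare, Finset.sum_ite_mem, Finset.univ_inter]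

lemma eagerShare_nonneg (hP : ∀ j o, 0 ≤ P j o) (r : ℕ) (j : N) (o : M) :
    0 ≤ eagerShare R P r j o := by
  rw [eagerShare]
  split_ifs
  exacts [hP j o, le_rfl]

lemma eagerShare_le (hP : ∀ j o, 0 ≤ P j o) (r : ℕ) (j : N) (o : M) :
    eagerShare R P r j o ≤ P j o := by
  rw [eagerShare]
  split_ifs
  exacts [le_rfl, hP j o]

lemma eagerShare_le_succ (hP : ∀ j o, 0 ≤ P j o) (r : ℕ) (j : N) (o : M) :
    eagerShare R P r j o ≤ eagerShare R P (r + 1) j o := by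
  by_cases h : j ∈ eagerAgents R P r o
  · exact (eagerShare_le hP r j o).trans_eq (eagerShare_succ_of_mem h).symm
  · exact (eagerShare_succ_of_notMem h).ge

lemma remainingItems_antitone (hP : ∀ j o, 0 ≤ P j o) : Antitone (remainingItems R P) :=
  antitone_nat_of_succ_le fun r o ho => by
    rw [mem_remainingItems] at ho ⊢
    exact (Finset.sum_le_sum fun j _ => eagerShare_le_succ hP r j o).trans_lt ho

lemma IsRandomAssignment.sum_eagerShare_le (hP : IsRandomAssignment P) (r : ℕ) (j : N) :
    ∑ o, eagerShare R P r j o ≤ 1 :=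
  hP.row_sum j ▸ Finset.sum_le_sum fun o _ => eagerShare_le hP.nonneg r j o

lemma IsRandomAssignment.eagerShare_eq_of_notMem_remainingItems (hP : IsRandomAssignment P)
    (ho : o ∉ remainingItems R P r) (j : N) : eagerShare R P r j o = P j o := by
  have hle : ∀ j ∈ Finset.univ, eagerShare R P r j o ≤ P j o := fun j _ =>
    eagerShare_le hP.nonneg r j o
  rw [mem_remainingItems, not_lt, ← hP.col_sum o] at ho
  exact (Finset.sum_eq_sum_iff_of_le hle).1 ((Finset.sum_le_sum hle).antisymm ho) j
    (Finset.mem_univ j)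

lemma IsRandomAssignment.card_pos (hP : IsRandomAssignment P) (j : N) : 0 < Fintype.card M := by
  rw [Fintype.card_pos_iff]
  by_contra hempty
  rw [not_nonempty_iff] at hempty
  simpa using hP.row_sum j

/-- The share that agent `j` gets by being eager for an item for the first time in round `r`. -/
noncomputable def roundShare (R : PrefProfile N M) (P : N → M → ℝ) (j : N) (r : ℕ) : ℝ :=
  ∑ o, eagerShare R P (r + 1) j o - ∑ o, eagerShare R P r j o

lemma roundShare_nonneg (hP : ∀ j o, 0 ≤ P j o) (j : N) (r : ℕ) : 0 ≤ roundShare R P j r :=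
  sub_nonneg.2 (Finset.sum_le_sum fun o _ => eagerShare_le_succ hP r j o)

lemma IsRandomAssignment.roundShare_le (hP : IsRandomAssignment P) (j : N) (r : ℕ) :
    roundShare R P j r ≤ 1 - ∑ o, eagerShare R P r j o :=
  sub_le_sub_right (hP.sum_eagerShare_le (r + 1) j) _

lemma sum_range_roundShare (j : N) (r : ℕ) :
    ∑ i ∈ Finset.range r, roundShare R P j i = ∑ o, eagerShare R P r j o := by
  simp only [roundShare, Finset.sum_range_sub fun i => ∑ o, eagerShare R P i j o, eagerShare_zero,
    Finset.sum_const_zero, sub_zero]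

lemma roundShare_of_mem (h : j ∈ eagerAgents R P r o) :
    roundShare R P j r = eagerShare R P (r + 1) j o - eagerShare R P r j o := by
  rw [roundShare, ← Finset.sum_sub_distrib]
  refine Finset.sum_eq_single_of_mem o (Finset.mem_univ o) fun o' _ hne => sub_eq_zero.2 ?_
  exact eagerShare_succ_of_notMem fun h' => hne (eq_of_mem_topAgents h h')

lemma sum_eagerAgents_roundShare (r : ℕ) (o : M) :
    ∑ j ∈ eagerAgents R P r o, roundShare R P j r =
      ∑ j, eagerShare R P (r + 1) j o - ∑ j, eagerShare R P r j o := by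
  rw [← Finset.sum_sub_distrib, Finset.sum_congr rfl fun j hj => roundShare_of_mem hj]
  exact Finset.sum_subset (Finset.subset_univ _) fun j _ hj =>
    sub_eq_zero.2 (eagerShare_succ_of_notMem hj)

lemma PREState.Consistent.available_eq_remainingItems {σ : PREState N M} {ω : N → ℝ → ℝ}
    (h : σ.Consistent ω) (hshare : σ.share = eagerShare R P r) :
    σ.available = remainingItems R P r := by
  ext o
  rw [h.mem_available, mem_remainingItems, ← hshare, ← (h.supply_nonneg o).lt_iff_ne',
    h.supply_eq, sub_pos]

end Eager

section OutputIsFERI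

variable {N M : Type*} [Fintype N] [Fintype M] {R : PrefProfile N M} {ω : N → ℝ → ℝ}

lemma preState_share_eq_eagerShare (h : PREHalts R ω) (hω : ∀ j, IsEatingSpeed (ω j)) (r : ℕ) :
    (preState R ω r).share = eagerShare R (PRE R ω) r := by
  induction r with
  | zero => exact funext₂ fun j o => eagerShare_zero.symm
  | succ r ih =>
    have heager : ∀ o, eagerAgents R (PRE R ω) r o =
        topAgents R (preState R ω r).available o := fun o => by
      rw [eagerAgents, (preState_consistent R hω r).available_eq_remainingItems ih]
    funext j o
    by_cases hj : j ∈ topAgents R (preState R ω r).available o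
    · obtain ⟨s, hrs, hs⟩ := h.exists_ge_PRE_eq_share (r + 1)
      rw [eagerShare_succ_of_mem (heager o ▸ hj), hs]
      exact preState_share_eq_of_mem_topAgents hω hj hrs
    · rw [eagerShare_succ_of_notMem (heager o ▸ hj), preState_succ,
        PREState.step_share_of_notMem hj, ih]

lemma preState_available_eq_remainingItems (h : PREHalts R ω) (hω : ∀ j, IsEatingSpeed (ω j))
    (r : ℕ) : (preState R ω r).available = remainingItems R (PRE R ω) r :=
  (preState_consistent R hω r).available_eq_remainingItems (preState_share_eq_eagerShare h hω r)

theorem exAnteFERI_PRE (h : PREHalts R ω) (hω : ∀ j, IsEatingSpeed (ω j)) :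
    ExAnteFERI R (PRE R ω) := by
  rintro r o ho j ⟨i, hir, hj⟩
  rw [eagerAgents, ← preState_available_eq_remainingItems h hω] at hj
  rw [← preState_available_eq_remainingItems h hω] at ho
  have hsated : (preState R ω (i + 1)).IsSated j :=
    preState_isSated hω hj (preState_available_antitone R ω hir ho)
  have hfinal : ∀ o', PRE R ω j o' = eagerShare R (PRE R ω) (i + 1) j o' := fun o' => by
    obtain ⟨s, his, hs⟩ := h.exists_ge_PRE_eq_share (i + 1)
    rw [← preState_share_eq_eagerShare h hω, hs, preState_share_eq_of_isSated hω hsated his]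
  have hrow : ∑ o', PRE R ω j o' = 1 := by
    rw [← hsated]
    simp only [hfinal, preState_share_eq_eagerShare h hω]
  rw [← hrow]
  refine Finset.sum_subset (Finset.subset_univ _) fun o' _ ho' => ?_
  rw [hfinal o']
  refine eagerShare_of_notMem fun hbefore => ho' ?_
  obtain ⟨i', hi', heager⟩ := (mem_eagerBefore ..).1 hbefore
  rw [eagerAgents, ← preState_available_eq_remainingItems h hω, mem_topAgents] at heager
  exact heager.mem_upperContour
    (preState_available_antitone R ω (Nat.le_of_lt_succ hi') (mem_topAgents.1 hj).1)

end OutputIsFERI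

section StepSpeed

/-- The speed that eats the amount `f r` at a constant rate during the `r`-th (counted from `0`)
of the `n` equal parts of the unit interval. -/
noncomputable def stepSpeed (n : ℕ) (f : ℕ → ℝ) (t : ℝ) : ℝ :=
  n * f ⌊n * t⌋₊

variable {n : ℕ} {f : ℕ → ℝ}

lemma stepSpeed_eqOn (hn : 0 < n) (r : ℕ) :
    Set.EqOn (stepSpeed n f) (fun _ => n * f r) (Set.Ico (r / n : ℝ) (r / n + 1 / n)) := by
  rintro x ⟨hrx, hxr⟩
  have hn' : (0 : ℝ) < n := Nat.cast_pos.2 hn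
  rw [← add_div, lt_div_iff₀' hn'] at hxr
  rw [div_le_iff₀' hn'] at hrx
  have hfloor : ⌊(n : ℝ) * x⌋₊ = r := (Nat.floor_eq_iff (r.cast_nonneg.trans hrx)).2 ⟨hrx, hxr⟩
  simp only [stepSpeed, hfloor]

lemma stepSpeed_eqOn_uIoo (hn : 0 < n) (r : ℕ) {ρ : ℝ} (hρ : 0 ≤ ρ) (hρn : ρ ≤ 1 / n) :
    Set.EqOn (stepSpeed n f) (fun _ => n * f r) (Set.uIoo (r / n : ℝ) (r / n + ρ)) := by
  rw [Set.uIoo_of_le (by linarith)]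
  exact (stepSpeed_eqOn hn r).mono
    (Set.Ioo_subset_Ico_self.trans (Set.Ico_subset_Ico_right (by gcongr)))

lemma integral_stepSpeed (hn : 0 < n) (r : ℕ) {ρ : ℝ} (hρ : 0 ≤ ρ) (hρn : ρ ≤ 1 / n) :
    ∫ x in (r / n : ℝ)..(r / n + ρ), stepSpeed n f x = n * ρ * f r := by
  rw [intervalIntegral.integral_congr_uIoo (stepSpeed_eqOn_uIoo hn r hρ hρn),
    intervalIntegral.integral_const, smul_eq_mul]
  ring

lemma isEatingSpeed_stepSpeed (hn : 0 < n) (hf : ∀ r, 0 ≤ f r)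
    (hsum : ∑ r ∈ Finset.range n, f r = 1) (hzero : ∀ r, n ≤ r → f r = 0) :
    IsEatingSpeed (stepSpeed n f) := by
  have hn' : (0 : ℝ) < n := Nat.cast_pos.2 hn
  have hsucc : ∀ r : ℕ, ((r + 1 : ℕ) / n : ℝ) = r / n + 1 / n := fun r => by
    push_cast
    exact add_div ..
  have hint : ∀ r < n, IntervalIntegrable (stepSpeed n f) volume (r / n : ℝ)
      ((r + 1 : ℕ) / n : ℝ) := fun r _ => by
    rw [hsucc]
    exact intervalIntegrable_const.congr_uIoo
      (stepSpeed_eqOn_uIoo hn r (by positivity) le_rfl).symm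
  refine ⟨?_, ?_, fun t _ => mul_nonneg hn'.le (hf _), fun t ht => ?_⟩
  · simpa [hn'.ne'] using IntervalIntegrable.trans_iterate (a := fun r : ℕ => (r / n : ℝ)) hint
  · have hpieces := intervalIntegral.sum_integral_adjacent_intervals
      (a := fun r : ℕ => (r / n : ℝ)) hint
    simp only [hsucc, integral_stepSpeed hn _ (by positivity : (0 : ℝ) ≤ 1 / n) le_rfl,
      mul_one_div_cancel hn'.ne', one_mul, hsum, Nat.cast_zero, zero_div, div_self hn'.ne']
      at hpieces
    exact hpieces.symm
  · have hfloor : n ≤ ⌊(n : ℝ) * t⌋₊ := Nat.le_floor (le_mul_of_one_le_right hn'.le ht.le)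
    rw [stepSpeed, hzero _ hfloor, mul_zero]

end StepSpeed

section FERIRounds

variable {N M : Type*} [Fintype N] [Fintype M] {R : PrefProfile N M} {P : N → M → ℝ}
  {r s : ℕ} {j : N} {o o' : M}

namespace ExAnteFERI

lemma apply_eq_zero (hF : ExAnteFERI R P) (hP : IsRandomAssignment P) (hrs : r < s)
    (hj : j ∈ eagerAgents R P r o) (ho : o ∈ remainingItems R P s)
    (ho' : o' ∉ upperContour R j o) : P j o' = 0 := by
  by_contra hne
  have hlt : ∑ o'' ∈ upperContour R j o, P j o'' < ∑ o'', P j o'' :=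
    Finset.sum_lt_sum_of_subset (Finset.subset_univ _) (Finset.mem_univ o') ho'
      ((hP.nonneg j o').lt_of_ne' hne) fun o'' _ _ => hP.nonneg j o''
  rw [hF s o ho j ⟨r, hrs, hj⟩, hP.row_sum] at hlt
  exact lt_irrefl 1 hlt

lemma eagerShare_eq (hF : ExAnteFERI R P) (hP : IsRandomAssignment P) (hrs : r < s)
    (hj : j ∈ eagerAgents R P r o) (ho : o ∈ remainingItems R P s) (o' : M) :
    eagerShare R P s j o' = P j o' := by
  by_cases ho' : o' ∈ upperContour R j o
  · rcases mem_upperContour.1 ho' with hpref | rfl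
    · have hexhausted : o' ∉ remainingItems R P r := (mem_topAgents.1 hj).notMem_of_pref hpref
      exact hP.eagerShare_eq_of_notMem_remainingItems
        (fun h => hexhausted (remainingItems_antitone hP.nonneg hrs.le h)) j
    · exact eagerShare_of_mem ((mem_eagerBefore ..).2 ⟨r, hrs, hj⟩)
  · have hzero := hF.apply_eq_zero hP hrs hj ho ho'
    exact le_antisymm (eagerShare_le hP.nonneg s j o')
      (hzero ▸ eagerShare_nonneg hP.nonneg s j o')

lemma sum_eagerShare_eq_one (hF : ExAnteFERI R P) (hP : IsRandomAssignment P) (hrs : r < s)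
    (hj : j ∈ eagerAgents R P r o) (ho : o ∈ remainingItems R P s) :
    ∑ o', eagerShare R P s j o' = 1 := by
  simp only [hF.eagerShare_eq hP hrs hj ho, hP.row_sum]

/-- If no item runs out in a round, then every agent is satisfied, so nothing remains. -/
lemma remainingItems_eq_empty (hF : ExAnteFERI R P) (hP : IsRandomAssignment P)
    (hr : Fintype.card M ≤ r) : remainingItems R P r = ∅ := by
  refine eq_empty_of_antitone_of_card_le (remainingItems_antitone hP.nonneg) (fun r heq => ?_) hr
  rw [Finset.eq_empty_iff_forall_notMem]
  intro o ho
  have hfinal : ∀ j, eagerShare R P (r + 1) j o = P j o := fun j => by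
    obtain ⟨o', hj⟩ := exists_mem_topAgents R j ⟨o, ho⟩
    exact hF.eagerShare_eq hP r.lt_succ_self hj (heq ▸ (mem_topAgents.1 hj).1) o
  rw [← heq, mem_remainingItems] at ho
  simp only [hfinal, hP.col_sum, lt_irrefl] at ho

lemma eagerShare_eq_of_card_le (hF : ExAnteFERI R P) (hP : IsRandomAssignment P)
    (hr : Fintype.card M ≤ r) : eagerShare R P r = P :=
  funext₂ fun j o => hP.eagerShare_eq_of_notMem_remainingItems
    (by simp [hF.remainingItems_eq_empty hP hr]) j

end ExAnteFERI

/-- Eating speeds that realise an ex-ante FERI assignment: in the `r`-th of `|M|` equal parts of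
the unit interval, an agent eats what she gets by being eager in round `r`. -/
noncomputable def feriSpeed (R : PrefProfile N M) (P : N → M → ℝ) (j : N) : ℝ → ℝ :=
  stepSpeed (Fintype.card M) (roundShare R P j)

lemma ExAnteFERI.isEatingSpeed_feriSpeed (hF : ExAnteFERI R P) (hP : IsRandomAssignment P)
    (j : N) : IsEatingSpeed (feriSpeed R P j) := by
  have hfinal : ∀ r, Fintype.card M ≤ r → ∑ o, eagerShare R P r j o = 1 := fun r hr => by
    rw [hF.eagerShare_eq_of_card_le hP hr, hP.row_sum]
  refine isEatingSpeed_stepSpeed (hP.card_pos j) (roundShare_nonneg hP.nonneg j) ?_ fun r hr => ?_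
  · rw [sum_range_roundShare, hfinal _ le_rfl]
  · rw [roundShare, hfinal r hr, hfinal (r + 1) (by omega), sub_self]

end FERIRounds

namespace PREState

variable {N M : Type*} [Fintype N] [Fintype M] {R : PrefProfile N M} {P : N → M → ℝ}
  {r : ℕ} {σ : PREState N M} {j : N} {o : M} {ρ : ℝ}

/-- The state `σ` of the algorithm run with `feriSpeed R P` is synchronised with the beginning of
round `r` in the definition of ex-ante FERI: the agents hold what they got by being eager before
round `r`, and those who are not sated yet are at the beginning of the `r`-th part of the unit
interval. -/
structure Tracks (R : PrefProfile N M) (P : N → M → ℝ) (r : ℕ) (σ : PREState N M) : Prop where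
  consistent : σ.Consistent (feriSpeed R P)
  share_eq : σ.share = eagerShare R P r
  isSated_or_time_eq : ∀ j, σ.IsSated j ∨ σ.time j = r / Fintype.card M

namespace Tracks

lemma available_eq (h : σ.Tracks R P r) : σ.available = remainingItems R P r :=
  h.consistent.available_eq_remainingItems h.share_eq

lemma mem_eagerAgents (h : σ.Tracks R P r) (hj : j ∈ topAgents R σ.available o) :
    j ∈ eagerAgents R P r o := by
  rwa [h.available_eq] at hj

lemma demand_eq (h : σ.Tracks R P r) (j : N) :
    ∫ x in (σ.time j)..1, feriSpeed R P j x = 1 - ∑ o, eagerShare R P r j o := by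
  rw [h.consistent.demand_eq, h.share_eq]

lemma sum_roundShare (h : σ.Tracks R P r) (o : M) :
    ∑ j ∈ topAgents R σ.available o, roundShare R P j r =
      σ.supply o - (1 - ∑ j, eagerShare R P (r + 1) j o) := by
  rw [h.available_eq, ← eagerAgents, sum_eagerAgents_roundShare, h.consistent.supply_eq, h.share_eq]
  ring

lemma roundShare_eq_zero (h : σ.Tracks R P r) (hP : IsRandomAssignment P) (hj : σ.IsSated j) :
    roundShare R P j r = 0 := by
  rw [IsSated, h.share_eq] at hj
  exact le_antisymm ((hP.roundShare_le j r).trans_eq (by rw [hj, sub_self]))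
    (roundShare_nonneg hP.nonneg j r)

lemma integral_eq (h : σ.Tracks R P r) (hω : IsEatingSpeed (feriSpeed R P j))
    (hP : IsRandomAssignment P) (hρ : 0 ≤ ρ) (hρM : ρ ≤ 1 / Fintype.card M) :
    ∫ x in (σ.time j)..(σ.time j + ρ), feriSpeed R P j x =
      Fintype.card M * ρ * roundShare R P j r := by
  rcases h.isSated_or_time_eq j with hsated | htime
  · have htime := h.consistent.time_nonneg j
    have hle := hω.integral_le_integral_to_one htime hρ
    rw [h.consistent.demand_eq, hsated, sub_self] at hle
    rw [h.roundShare_eq_zero hP hsated, mul_zero]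
    exact hle.antisymm (hω.integral_nonneg htime hρ)
  · rw [htime]
    exact integral_stepSpeed (hP.card_pos j) r hρ hρM

lemma sum_integral_eq (h : σ.Tracks R P r) (hF : ExAnteFERI R P) (hP : IsRandomAssignment P)
    (ho : o ∉ remainingItems R P (r + 1)) (hρ : 0 ≤ ρ) (hρM : ρ ≤ 1 / Fintype.card M) :
    ∑ j ∈ topAgents R σ.available o, ∫ x in (σ.time j)..(σ.time j + ρ), feriSpeed R P j x =
      Fintype.card M * ρ * σ.supply o := by
  rw [Finset.sum_congr rfl fun j _ => h.integral_eq (hF.isEatingSpeed_feriSpeed hP j) hP hρ hρM,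
    ← Finset.mul_sum, h.sum_roundShare]
  simp only [hP.eagerShare_eq_of_notMem_remainingItems ho, hP.col_sum, sub_self, sub_zero]

lemma duration_eq (h : σ.Tracks R P r) (hF : ExAnteFERI R P) (hP : IsRandomAssignment P)
    (ho : o ∈ σ.available) (ho' : o ∉ remainingItems R P (r + 1)) :
    σ.duration R (feriSpeed R P) o = 1 / Fintype.card M := by
  have hM : (0 : ℝ) < Fintype.card M := Nat.cast_pos.2 (Fintype.card_pos_iff.2 ⟨o⟩)
  refine consumptionTime_eq (hF.isEatingSpeed_feriSpeed hP) h.consistent.time_nonneg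
    (by positivity) ?_ fun ρ hρ hlt => ?_
  · rw [h.sum_integral_eq hF hP ho' (by positivity) le_rfl, mul_one_div_cancel hM.ne', one_mul]
  · rw [h.sum_integral_eq hF hP ho' hρ hlt.le]
    rw [lt_div_iff₀' hM] at hlt
    exact mul_lt_of_lt_one_left (h.consistent.supply_pos ho) hlt

lemma amount_le_roundShare (h : σ.Tracks R P r) (hF : ExAnteFERI R P)
    (hP : IsRandomAssignment P) (hj : j ∈ topAgents R σ.available o)
    (ho : o ∈ remainingItems R P (r + 1)) :
    σ.amount R (feriSpeed R P) j o ≤ roundShare R P j r := by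
  have hω := hF.isEatingSpeed_feriSpeed hP
  rw [roundShare, hF.sum_eagerShare_eq_one hP r.lt_succ_self (h.mem_eagerAgents hj) ho,
    ← h.demand_eq]
  exact (hω j).integral_le_integral_to_one (h.consistent.time_nonneg j)
    (h.consistent.duration_nonneg hω o)

lemma mem_step_available (h : σ.Tracks R P r) (hF : ExAnteFERI R P)
    (hP : IsRandomAssignment P) (ho : o ∈ remainingItems R P (r + 1)) :
    o ∈ (σ.step R (feriSpeed R P)).available := by
  rw [(h.consistent.step (hF.isEatingSpeed_feriSpeed hP)).mem_available]
  refine (sub_pos.2 ?_).ne'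
  have heaten := Finset.sum_le_sum fun j hj => h.amount_le_roundShare hF hP hj ho
  rw [h.sum_roundShare] at heaten
  exact heaten.trans_lt (sub_lt_self _ (sub_pos.2 (mem_remainingItems.1 ho)))

lemma amount_eq (h : σ.Tracks R P r) (hF : ExAnteFERI R P) (hP : IsRandomAssignment P)
    (hj : j ∈ topAgents R σ.available o) :
    σ.amount R (feriSpeed R P) j o = roundShare R P j r := by
  have hω := hF.isEatingSpeed_feriSpeed hP
  by_cases ho : o ∈ remainingItems R P (r + 1)
  · have hsated := h.consistent.isSated_step hω hj (h.mem_step_available hF hP ho)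
    rw [IsSated, sum_step_share_of_mem hj, h.share_eq] at hsated
    rw [roundShare, hF.sum_eagerShare_eq_one hP r.lt_succ_self (h.mem_eagerAgents hj) ho]
    exact eq_sub_of_add_eq' hsated
  · have hM : (Fintype.card M : ℝ) ≠ 0 := Nat.cast_ne_zero.2 (hP.card_pos j).ne'
    rw [amount, h.duration_eq hF hP (mem_topAgents.1 hj).1 ho,
      h.integral_eq (hω j) hP (by positivity) le_rfl, mul_one_div_cancel hM, one_mul]

lemma step_share_eq (h : σ.Tracks R P r) (hF : ExAnteFERI R P) (hP : IsRandomAssignment P) :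
    (σ.step R (feriSpeed R P)).share = eagerShare R P (r + 1) := by
  funext j o
  by_cases hj : j ∈ topAgents R σ.available o
  · rw [step_share_of_mem hj, h.amount_eq hF hP hj, roundShare_of_mem (h.mem_eagerAgents hj),
      h.share_eq, add_sub_cancel]
  · rw [step_share_of_notMem hj, h.share_eq, eagerShare_succ_of_notMem]
    rwa [eagerAgents, ← h.available_eq]

lemma isSated_step_or_time_eq (h : σ.Tracks R P r) (hF : ExAnteFERI R P)
    (hP : IsRandomAssignment P) (j : N) :
    (σ.step R (feriSpeed R P)).IsSated j ∨
      (σ.step R (feriSpeed R P)).time j = (r + 1 : ℕ) / Fintype.card M := by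
  rw [IsSated, h.step_share_eq hF hP]
  rcases σ.available.eq_empty_or_nonempty with hempty | hne
  · left
    have hnext : ∀ o, o ∉ remainingItems R P (r + 1) := fun o ho => by
      simpa [← h.available_eq, hempty] using remainingItems_antitone hP.nonneg r.le_succ ho
    simp only [hP.eagerShare_eq_of_notMem_remainingItems (hnext _), hP.row_sum]
  obtain ⟨o, hj⟩ := exists_mem_topAgents R j hne
  by_cases ho : o ∈ remainingItems R P (r + 1)
  · exact Or.inl (hF.sum_eagerShare_eq_one hP r.lt_succ_self (h.mem_eagerAgents hj) ho)
  refine (h.isSated_or_time_eq j).imp (fun hsated => ?_) fun htime => ?_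
  · have hround := sub_eq_zero.1 (h.roundShare_eq_zero hP hsated)
    rwa [← h.share_eq, hsated] at hround
  · rw [step_time_of_mem hj, htime, h.duration_eq hF hP (mem_topAgents.1 hj).1 ho]
    push_cast
    exact (add_div ..).symm

protected lemma step (h : σ.Tracks R P r) (hF : ExAnteFERI R P) (hP : IsRandomAssignment P) :
    (σ.step R (feriSpeed R P)).Tracks R P (r + 1) where
  consistent := h.consistent.step (hF.isEatingSpeed_feriSpeed hP)
  share_eq := h.step_share_eq hF hP
  isSated_or_time_eq := h.isSated_step_or_time_eq hF hP

end Tracks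

end PREState

namespace ExAnteFERI

variable {N M : Type*} [Fintype N] [Fintype M] {R : PrefProfile N M} {P : N → M → ℝ}

lemma preState_tracks (hF : ExAnteFERI R P) (hP : IsRandomAssignment P) (r : ℕ) :
    (preState R (feriSpeed R P) r).Tracks R P r := by
  induction r with
  | zero =>
    exact ⟨PREState.consistent_init (hF.isEatingSpeed_feriSpeed hP),
      funext₂ fun j o => eagerShare_zero.symm, fun j => Or.inr (by simp [preState, PREState.init])⟩
  | succ r ih => exact preState_succ R _ r ▸ ih.step hF hP

theorem PRE_feriSpeed (hF : ExAnteFERI R P) (hP : IsRandomAssignment P) :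
    PRE R (feriSpeed R P) = P := by
  have htracks := hF.preState_tracks hP (Fintype.card M)
  rw [PRE_eq_share (htracks.available_eq.trans (hF.remainingItems_eq_empty hP le_rfl)),
    htracks.share_eq, hF.eagerShare_eq_of_card_le hP le_rfl]

end ExAnteFERI

theorem mainTheorem3 {N M : Type*} [Fintype N] [Fintype M]
    (hcard : Fintype.card N = Fintype.card M) (R : PrefProfile N M) :
    (∀ ω : N → ℝ → ℝ, (∀ j, IsEatingSpeed (ω j)) →
      PREHalts R ω ∧ IsRandomAssignment (PRE R ω)) ∧
    ∀ P : N → M → ℝ, IsRandomAssignment P →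
      (ExAnteFERI R P ↔ ∃ ω : N → ℝ → ℝ, (∀ j, IsEatingSpeed (ω j)) ∧ P = PRE R ω) := by
  refine ⟨fun ω hω => ⟨preHalts hcard.ge R hω, isRandomAssignment_PRE hcard R hω⟩,
    fun P hP => ⟨fun hF => ?_, ?_⟩⟩
  · exact ⟨feriSpeed R P, hF.isEatingSpeed_feriSpeed hP, (hF.PRE_feriSpeed hP).symm⟩
  · rintro ⟨ω, hω, rfl⟩
    exact exAnteFERI_PRE (preHalts hcard.ge R hω) hω
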